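/- Let $\Xi_0=[-1,1]$ and, for $n=0,1,2,\dots$, let $\Xi_{n+1}=\Xi_n\cap[a_{n+1}-1,a_{n+1}+1]$, where the point $a_{n+1}$ is random and, conditionally on $a_1,\dots,a_n$, uniformly distributed on the segment $\Xi_n$. Let $\rho_n$ denote the radius (half of the length) of $\Xi_n$. Then, as $n\to\infty$, \[ n\left(\rho_n-\tfrac12\right)\longrightarrow \mathrm{Exp}(4)\quad\text{in distribution}, \] where $\mathrm{Exp}(4)$ is the exponential distribution with rate $4$ (mean $1/4$). Moreover, for every integer $k\ge 1$, the random variable $n^k\left(\rho_n-\tfrac12\right)^k$ is integrable for all $n$, and \[ \lim_{n\to\infty}\mathbb{E}\left[n^k\left(\rho_n-\tfrac12\right)^k\right]=\frac{k!}{4^k}. \] -/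

import Mathlib

open MeasureTheory ProbabilityTheory Filter Topology
open scoped Nat

/-- The segments cut out by a sequence of points: `Ξ₀ = [-1, 1]` and
`Ξₙ₊₁ = Ξₙ ∩ [aₙ₊₁ - 1, aₙ₊₁ + 1]`. The sequence is indexed from `0`, so that `x n` is the point
`aₙ₊₁`, the one that is chosen on `Ξₙ`. -/
def segments (x : ℕ → ℝ) : ℕ → Set ℝ
  | 0 => Set.Icc (-1) 1
  | n + 1 => segments x n ∩ Set.Icc (x n - 1) (x n + 1)

/-- The radius of a segment: half of its length. -/
noncomputable def segmentRadius (s : Set ℝ) : ℝ := Metric.diam s / 2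

theorem segmentRadius_Icc {z r : ℝ} (hr : 0 ≤ r) :
    segmentRadius (Set.Icc (z - r) (z + r)) = r := by
  unfold segmentRadius
  rw [Real.diam_Icc (by linarith)]
  ring

/-- `a 0, a 1, …` are the random points of the diminishing segment process on the probability
space `(Ω, P)`: conditionally on the past `a 0, …, a (n - 1)`, the point `a n` is uniformly
distributed on the current segment `Ξₙ`, that is, almost surely
`P(a n ∈ B | a 0, …, a (n - 1)) = |B ∩ Ξₙ| / |Ξₙ|` for every Borel set `B`. -/
structure IsDiminishingSegmentProcess {Ω : Type*} [MeasurableSpace Ω] (P : Measure Ω)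
    (a : ℕ → Ω → ℝ) : Prop where
  measurable : ∀ n, Measurable (a n)
  uniform : ∀ (n : ℕ) (B : Set ℝ), MeasurableSet B →
    P⟦a n ⁻¹' B | MeasurableSpace.comap (fun ω (i : Fin n) => a i ω) MeasurableSpace.pi⟧
      =ᵐ[P] fun ω =>
        volume.real (B ∩ segments (fun i => a i ω) n) / volume.real (segments (fun i => a i ω) n)

/-- The radius `ρₙ` of the `n`-th segment, as a random variable. -/
noncomputable def radius {Ω : Type*} (a : ℕ → Ω → ℝ) (n : ℕ) (ω : Ω) : ℝ :=
  segmentRadius (segments (fun i => a i ω) n)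

instance isProbabilityMeasure_expMeasure_four : IsProbabilityMeasure (expMeasure 4) :=
  isProbabilityMeasure_expMeasure (by norm_num)

/-! Let D_n = ρ_n - 1/2. A uniform cut keeps D above x exactly when the cut point is farther than 2x
from both ends, so given D_n = d > x the survival probability is 1 - 4x/(1+2d). Only the resulting
recursion for the tails P(D_n > x) is used.

Bounding 1+2d below by 1 gives P(D_n > x) ≥ (1-4x)^n. Bounding it above by 2 gives the crude tail
exp(-2nx), hence E D_n ≤ 1/(2n). The inequality 1/(1+2d) ≥ 1-2d gives (1-4x)^n from above, up to an
error 8x ∑_{j<n} E D_j. At x = t/n this error is 8t times a Cesàro mean of a null sequence, so both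
bounds tend to exp(-4t) (`tendsto_measureReal`). Moments follow by the layer-cake formula and
dominated convergence, the crude tail serving as majorant (`tendsto_integral_pow`). -/

/-! ### Endpoints of the segments -/

/-- The lower end of the `n`-th segment. -/
noncomputable def lowerEnd (x : ℕ → ℝ) : ℕ → ℝ
  | 0 => -1
  | n + 1 => max (lowerEnd x n) (x n - 1)

/-- The upper end of the `n`-th segment. -/
noncomputable def upperEnd (x : ℕ → ℝ) : ℕ → ℝ
  | 0 => 1
  | n + 1 => min (upperEnd x n) (x n + 1)

theorem segments_eq_Icc (x : ℕ → ℝ) (n : ℕ) :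
    segments x n = Set.Icc (lowerEnd x n) (upperEnd x n) := by
  induction n with
  | zero => rfl
  | succ n ih => rw [segments, ih, Set.Icc_inter_Icc]; rfl

theorem segmentRadius_Icc_eq_max (l r : ℝ) : segmentRadius (Set.Icc l r) = max (r - l) 0 / 2 := by
  unfold segmentRadius
  rcases le_or_gt l r with h | h
  · rw [Real.diam_Icc h, max_eq_left (by linarith)]
  · rw [Set.Icc_eq_empty (by linarith), Metric.diam_empty, max_eq_right (by linarith)]

theorem upperEnd_sub_lowerEnd_le_two (x : ℕ → ℝ) (n : ℕ) : upperEnd x n - lowerEnd x n ≤ 2 := by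
  induction n with
  | zero => norm_num [upperEnd, lowerEnd]
  | succ n ih =>
    rw [upperEnd, lowerEnd]
    linarith [min_le_right (upperEnd x n) (x n + 1), le_max_right (lowerEnd x n) (x n - 1)]

/-- An end that gets clipped lies at distance 1 from the cut point, which itself stays in the
segment; if both are clipped the length is 2. -/
theorem one_le_upperEnd_sub_lowerEnd_succ {x : ℕ → ℝ} {n : ℕ}
    (h : 1 ≤ upperEnd x n - lowerEnd x n) (hx : x n ∈ Set.Icc (lowerEnd x n) (upperEnd x n)) :
    1 ≤ upperEnd x (n + 1) - lowerEnd x (n + 1) := by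
  rw [upperEnd, lowerEnd]
  obtain ⟨h₁, h₂⟩ := hx
  rcases max_cases (lowerEnd x n) (x n - 1) with h₃ | h₃ <;>
    rcases min_cases (upperEnd x n) (x n + 1) with h₄ | h₄ <;> linarith

/-! ### Conditional uniformity realised by an independent uniform variable -/

section Uniform

variable {Ω : Type*} {m m₀ : MeasurableSpace Ω} {P : Measure Ω}

theorem volume_preimage_affine {l r : ℝ} (h : l < r) {B : Set ℝ} (hB : MeasurableSet B) :
    volume.restrict (Set.Icc 0 1) {u : ℝ | l + (r - l) * u ∈ B} =
      ENNReal.ofReal (volume.real (B ∩ Set.Icc l r) / volume.real (Set.Icc l r)) := by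
  have hd : 0 < r - l := sub_pos.2 h
  have hset : {u : ℝ | l + (r - l) * u ∈ B} ∩ Set.Icc 0 1 =
      (fun u => (r - l) * u) ⁻¹' ((fun u => l + u) ⁻¹' (B ∩ Set.Icc l r)) := by
    ext u
    simp only [Set.mem_inter_iff, Set.mem_ofPred_eq, Set.mem_Icc, Set.mem_preimage]
    refine and_congr_right fun _ => and_congr ?_ ?_
    · rw [le_add_iff_nonneg_right, mul_nonneg_iff_of_pos_left hd]
    · constructor <;> intro <;> nlinarith
  have hBm : MeasurableSet {u : ℝ | l + (r - l) * u ∈ B} :=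
    (show Measurable fun u : ℝ => l + (r - l) * u by fun_prop) hB
  rw [Measure.restrict_apply hBm, hset, Real.volume_preimage_mul_left hd.ne',
    measure_preimage_add, abs_of_pos (inv_pos.2 hd), Real.volume_real_Icc_of_le h.le,
    div_eq_inv_mul, ENNReal.ofReal_mul (inv_pos.2 hd).le, ofReal_measureReal
    (measure_ne_top_of_subset Set.inter_subset_right (by simp))]

/-- If `A` is conditionally uniform on the segment `[L, R]` given `m`, and the ends are
`m`-measurable, then the joint law of `(L, R)` and `A` is that of `(L, R)` and `L + (R - L) U` with
`U` uniform on `[0, 1]` and independent of `(L, R)`. -/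
theorem map_prodMk_eq_of_condExp_uniform [IsProbabilityMeasure P]
    (hm : m ≤ m₀) {L R A : Ω → ℝ} (hL : Measurable[m] L) (hR : Measurable[m] R)
    (hA : Measurable A) (hlt : ∀ᵐ ω ∂P, L ω < R ω)
    (hu : ∀ B, MeasurableSet B → P⟦A ⁻¹' B | m⟧ =ᵐ[P] fun ω =>
      volume.real (B ∩ Set.Icc (L ω) (R ω)) / volume.real (Set.Icc (L ω) (R ω))) :
    P.map (fun ω => ((L ω, R ω), A ω)) =
      ((P.map fun ω => (L ω, R ω)).prod (volume.restrict (Set.Icc (0 : ℝ) 1))).map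
        fun q => (q.1, q.1.1 + (q.1.2 - q.1.1) * q.2) := by
  have hLR : Measurable[m] fun ω => (L ω, R ω) := hL.prodMk hR
  have hLR₀ : Measurable fun ω => (L ω, R ω) := hLR.mono hm le_rfl
  have hf : Measurable fun q : (ℝ × ℝ) × ℝ => (q.1, q.1.1 + (q.1.2 - q.1.1) * q.2) := by
    fun_prop
  have : IsProbabilityMeasure (P.map fun ω => ((L ω, R ω), A ω)) :=
    Measure.isProbabilityMeasure_map (hLR₀.prodMk hA).aemeasurable
  -- Rectangles suffice; on them the claim is the defining property of the conditional expectation,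
  -- integrated over an `m`-measurable set.
  refine Measure.ext_prod fun {s t} hs ht => ?_
  rw [Measure.map_apply (hLR₀.prodMk hA) (hs.prod ht), Measure.map_apply hf (hs.prod ht),
    Measure.prod_apply (hf (hs.prod ht)), lintegral_map (measurable_measure_prodMk_left
      (hf (hs.prod ht))) hLR₀]
  have hsm : MeasurableSet[m] ((fun ω => (L ω, R ω)) ⁻¹' s) := hLR hs
  have hA' : MeasurableSet (A ⁻¹' t) := hA ht
  have hint : Integrable ((A ⁻¹' t).indicator fun _ => (1 : ℝ)) P :=
    (integrable_const 1).indicator hA'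
  have key := setIntegral_condExp hm hint hsm
  rw [setIntegral_indicator hA', setIntegral_const, smul_eq_mul, mul_one] at key
  have hle : (fun ω => ((L ω, R ω), A ω)) ⁻¹' s ×ˢ t = (fun ω => (L ω, R ω)) ⁻¹' s ∩ A ⁻¹' t := rfl
  have hnn : 0 ≤ᵐ[P] P⟦A ⁻¹' t | m⟧ := by
    filter_upwards [hu t ht] with ω hω
    rw [hω]
    exact div_nonneg measureReal_nonneg measureReal_nonneg
  rw [hle, ← ofReal_measureReal, ← key, ofReal_integral_eq_lintegral_ofReal
    integrable_condExp.integrableOn (ae_restrict_of_ae hnn),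
    ← lintegral_indicator (hm _ hsm)]
  refine lintegral_congr_ae ?_
  filter_upwards [hlt, hu t ht] with ω hω hω'
  by_cases h : (L ω, R ω) ∈ s
  · rw [Set.indicator_of_mem (by exact h), hω', ← volume_preimage_affine hω ht]
    congr 1
    ext u
    simp [h]
  · rw [Set.indicator_of_notMem (by exact h)]
    symm
    convert measure_empty
    · ext u
      simp [h]
    · infer_instance

/-- General `S` is needed because the events of interest couple the cut point with the ends. -/
theorem measure_eq_lintegral_of_condExp_uniform [IsProbabilityMeasure P]
    (hm : m ≤ m₀) {L R A : Ω → ℝ} (hL : Measurable[m] L) (hR : Measurable[m] R)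
    (hA : Measurable A) (hlt : ∀ᵐ ω ∂P, L ω < R ω)
    (hu : ∀ B, MeasurableSet B → P⟦A ⁻¹' B | m⟧ =ᵐ[P] fun ω =>
      volume.real (B ∩ Set.Icc (L ω) (R ω)) / volume.real (Set.Icc (L ω) (R ω)))
    {S : Set ((ℝ × ℝ) × ℝ)} (hS : MeasurableSet S) :
    P {ω | ((L ω, R ω), A ω) ∈ S} = ∫⁻ ω, volume.restrict (Set.Icc 0 1)
      {u : ℝ | ((L ω, R ω), L ω + (R ω - L ω) * u) ∈ S} ∂P := by
  have hLR₀ : Measurable fun ω => (L ω, R ω) := (hL.prodMk hR).mono hm le_rfl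
  have hf : Measurable fun q : (ℝ × ℝ) × ℝ => (q.1, q.1.1 + (q.1.2 - q.1.1) * q.2) := by
    fun_prop
  have h := congrArg (fun μ => μ S) (map_prodMk_eq_of_condExp_uniform hm hL hR hA hlt hu)
  beta_reduce at h
  rw [Measure.map_apply (hLR₀.prodMk hA) hS, Measure.map_apply hf hS,
    Measure.prod_apply (hf hS), lintegral_map (measurable_measure_prodMk_left (hf hS)) hLR₀] at h
  exact h

end Uniform

/-! ### Transition probabilities of the radius -/

/-- The part of `[0, 1]` on which the cut leaves a segment of radius above `1 / 2 + x`. -/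
theorem volume_restrict_setOf_lt_min_sub_max {l r x : ℝ} (h : 1 ≤ r - l) (h₂ : r - l ≤ 2)
    (hx : 0 ≤ x) :
    volume.restrict (Set.Icc 0 1) {u : ℝ | 1 + 2 * x <
        min r (l + (r - l) * u + 1) - max l (l + (r - l) * u - 1)} =
      ENNReal.ofReal (if 1 + 2 * x < r - l then 1 - 4 * x / (r - l) else 0) := by
  have hd : 0 < r - l := by linarith
  have hmeas : MeasurableSet {u : ℝ | 1 + 2 * x <
      min r (l + (r - l) * u + 1) - max l (l + (r - l) * u - 1)} :=
    measurableSet_lt (by fun_prop) (by fun_prop)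
  rw [Measure.restrict_apply hmeas]
  split_ifs with hxd
  -- Of the four possible kept lengths, `r - l` and 2 exceed `1 + 2 * x` already; the other two
  -- require distance more than `2 * x` from each end.
  · have : {u : ℝ | 1 + 2 * x < min r (l + (r - l) * u + 1) - max l (l + (r - l) * u - 1)} ∩
        Set.Icc 0 1 = Set.Ioo (2 * x / (r - l)) (1 - 2 * x / (r - l)) := by
      ext u
      have e₁ : 2 * x / (r - l) < u ↔ 2 * x < (r - l) * u := by rw [div_lt_iff₀' hd]
      have e₂ : u < 1 - 2 * x / (r - l) ↔ 2 * x < (r - l) * (1 - u) := by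
        rw [lt_sub_comm, div_lt_iff₀' hd]
      have hx₀ : 0 ≤ 2 * x / (r - l) := by positivity
      simp only [Set.mem_inter_iff, Set.mem_ofPred_eq, Set.mem_Icc, Set.mem_Ioo]
      constructor
      · rintro ⟨hu, -⟩
        rw [e₁, e₂]
        constructor
        · linarith [min_le_right r (l + (r - l) * u + 1), le_max_left l (l + (r - l) * u - 1)]
        · linarith [min_le_left r (l + (r - l) * u + 1), le_max_right l (l + (r - l) * u - 1)]
      · rintro ⟨hu₁, hu₂⟩
        refine ⟨?_, by linarith, by linarith⟩
        rw [e₁] at hu₁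
        rw [e₂] at hu₂
        rcases min_cases r (l + (r - l) * u + 1) with h₃ | h₃ <;>
          rcases max_cases l (l + (r - l) * u - 1) with h₄ | h₄ <;> linarith
    rw [this, Real.volume_Ioo]
    congr 1
    ring
  · rw [ENNReal.ofReal_zero]
    convert measure_empty
    · refine Set.eq_empty_of_forall_notMem ?_
      rintro u ⟨hu, -⟩
      rw [Set.mem_ofPred_eq] at hu
      linarith [min_le_left r (l + (r - l) * u + 1), le_max_left l (l + (r - l) * u - 1)]
    · infer_instance

/-- The excess over `1 / 2` of the radius of a diminishing segment, as a Markov process on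
`[0, 1 / 2]` started at `1 / 2`: the next value exceeds `x` with conditional probability
`1 - 4 x / (1 + 2 d)` if the present value `d` exceeds `x`, and `0` otherwise. -/
structure IsRadiusExcess {Ω : Type*} [MeasurableSpace Ω] (P : Measure Ω) (D : ℕ → Ω → ℝ) :
    Prop where
  measurable : ∀ n, Measurable (D n)
  mem_Icc : ∀ n, ∀ᵐ ω ∂P, D n ω ∈ Set.Icc 0 (1 / 2)
  zero : ∀ ω, D 0 ω = 1 / 2
  measureReal_succ : ∀ n x, 0 ≤ x → P.real {ω | x < D (n + 1) ω} =
    ∫ ω in {ω | x < D n ω}, (1 - 4 * x / (1 + 2 * D n ω)) ∂P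

theorem measurable_lowerEnd {Ω : Type*} {m : MeasurableSpace Ω} {a : ℕ → Ω → ℝ} {n : ℕ}
    (h : ∀ i < n, Measurable (a i)) : Measurable fun ω => lowerEnd (fun i => a i ω) n := by
  induction n with
  | zero => exact measurable_const
  | succ n ih =>
    exact (ih fun i hi => h i (by omega)).max ((h n (by omega)).sub_const 1)

theorem measurable_upperEnd {Ω : Type*} {m : MeasurableSpace Ω} {a : ℕ → Ω → ℝ} {n : ℕ}
    (h : ∀ i < n, Measurable (a i)) : Measurable fun ω => upperEnd (fun i => a i ω) n := by
  induction n with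
  | zero => exact measurable_const
  | succ n ih =>
    exact (ih fun i hi => h i (by omega)).min ((h n (by omega)).add_const 1)

theorem radius_eq {Ω : Type*} [MeasurableSpace Ω] (a : ℕ → Ω → ℝ) (n : ℕ) (ω : Ω) :
    radius a n ω =
      max (upperEnd (fun i => a i ω) n - lowerEnd (fun i => a i ω) n) 0 / 2 := by
  rw [radius, segments_eq_Icc, segmentRadius_Icc_eq_max]

theorem measurable_radius {Ω : Type*} [MeasurableSpace Ω] {a : ℕ → Ω → ℝ}
    (ha : ∀ n, Measurable (a n)) (n : ℕ) : Measurable (radius a n) := by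
  rw [funext (radius_eq a n)]
  exact (((measurable_upperEnd fun i _ => ha i).sub
    (measurable_lowerEnd fun i _ => ha i)).max measurable_const).div_const 2

namespace IsDiminishingSegmentProcess

variable {Ω : Type*} [MeasurableSpace Ω] {P : Measure Ω} [IsProbabilityMeasure P]
  {a : ℕ → Ω → ℝ}

theorem measure_eq_lintegral (ha : IsDiminishingSegmentProcess P a) (n : ℕ)
    (hn : ∀ᵐ ω ∂P, 1 ≤ upperEnd (fun i => a i ω) n - lowerEnd (fun i => a i ω) n)
    {S : Set ((ℝ × ℝ) × ℝ)} (hS : MeasurableSet S) :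
    P {ω | ((lowerEnd (fun i => a i ω) n, upperEnd (fun i => a i ω) n), a n ω) ∈ S} =
      ∫⁻ ω, volume.restrict (Set.Icc 0 1) {u : ℝ |
        ((lowerEnd (fun i => a i ω) n, upperEnd (fun i => a i ω) n),
          lowerEnd (fun i => a i ω) n +
            (upperEnd (fun i => a i ω) n - lowerEnd (fun i => a i ω) n) * u) ∈ S} ∂P := by
  have hmeas : ∀ i < n,
      Measurable[MeasurableSpace.comap (fun ω (i : Fin n) => a i ω) MeasurableSpace.pi] (a i) := by
    intro i hi
    exact (measurable_pi_apply (X := fun _ : Fin n => ℝ) ⟨i, hi⟩).comp (comap_measurable _)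
  refine measure_eq_lintegral_of_condExp_uniform
    (m := MeasurableSpace.comap (fun ω (i : Fin n) => a i ω) MeasurableSpace.pi)
    (Measurable.comap_le (measurable_pi_lambda _ fun i => ha.measurable i))
    (measurable_lowerEnd hmeas) (measurable_upperEnd hmeas) (ha.measurable n)
    (hn.mono fun ω hω => by linarith) (fun B hB => ?_) hS
  simpa only [segments_eq_Icc] using ha.uniform n B hB

theorem ae_one_le_upperEnd_sub_lowerEnd (ha : IsDiminishingSegmentProcess P a) (n : ℕ) :
    ∀ᵐ ω ∂P, 1 ≤ upperEnd (fun i => a i ω) n - lowerEnd (fun i => a i ω) n := by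
  induction n with
  | zero => exact ae_of_all _ fun ω => by norm_num [upperEnd, lowerEnd]
  | succ n ih =>
    -- The event that the cut point misses its segment is null, as `l + (r - l) * u` never does for
    -- `u` in `[0, 1]`.
    have hS : MeasurableSet {q : (ℝ × ℝ) × ℝ | q.2 ∈ Set.Icc q.1.1 q.1.2}ᶜ :=
      ((measurableSet_le (by fun_prop) measurable_snd).inter
        (measurableSet_le measurable_snd (by fun_prop))).compl
    have h₀ := ha.measure_eq_lintegral n ih hS
    rw [lintegral_congr_ae (g := fun _ => 0), lintegral_zero] at h₀
    · have h₁ : ∀ᵐ ω ∂P, a n ω ∈ Set.Icc (lowerEnd (fun i => a i ω) n)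
          (upperEnd (fun i => a i ω) n) := h₀
      filter_upwards [ih, h₁] with ω h h' using one_le_upperEnd_sub_lowerEnd_succ h h'
    · filter_upwards [ih] with ω hω
      rw [← le_zero_iff, Measure.restrict_apply₀']
      · refine (measure_mono (t := ∅) ?_).trans_eq measure_empty
        rintro u ⟨hu, hu₁, hu₂⟩
        refine hu ⟨?_, ?_⟩ <;> dsimp only <;> nlinarith
      · exact measurableSet_Icc.nullMeasurableSet

theorem isRadiusExcess (ha : IsDiminishingSegmentProcess P a) :
    IsRadiusExcess P fun n ω => radius a n ω - 1 / 2 where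
  measurable n := (measurable_radius ha.measurable n).sub_const _
  mem_Icc n := by
    filter_upwards [ha.ae_one_le_upperEnd_sub_lowerEnd n] with ω hω
    rw [radius_eq, max_eq_left (by linarith)]
    constructor <;> linarith [upperEnd_sub_lowerEnd_le_two (fun i => a i ω) n]
  zero ω := by norm_num [radius_eq, upperEnd, lowerEnd]
  measureReal_succ n x hx := by
    have hn := ha.ae_one_le_upperEnd_sub_lowerEnd n
    have hD : Measurable fun ω => radius a n ω - 1 / 2 :=
      (measurable_radius ha.measurable n).sub_const _
    have hset : MeasurableSet {ω | x < radius a n ω - 1 / 2} := measurableSet_lt measurable_const hD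
    have hS : MeasurableSet {q : (ℝ × ℝ) × ℝ |
        1 + 2 * x < min q.1.2 (q.2 + 1) - max q.1.1 (q.2 - 1)} :=
      measurableSet_lt (by fun_prop) (by fun_prop)
    have h₁ : {ω | x < radius a (n + 1) ω - 1 / 2} =
        {ω | ((lowerEnd (fun i => a i ω) n, upperEnd (fun i => a i ω) n), a n ω) ∈
          {q : (ℝ × ℝ) × ℝ | 1 + 2 * x < min q.1.2 (q.2 + 1) - max q.1.1 (q.2 - 1)}} := by
      ext ω
      simp only [Set.mem_ofPred_eq, radius_eq, upperEnd, lowerEnd]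
      rw [lt_sub_iff_add_lt, lt_div_iff₀ two_pos, lt_max_iff]
      constructor
      · rintro (h | h) <;> linarith
      · intro h
        left
        linarith
    rw [measureReal_def, h₁, ha.measure_eq_lintegral n hn hS, ← integral_indicator hset,
      integral_eq_lintegral_of_nonneg_ae]
    · congr 1
      refine lintegral_congr_ae ?_
      filter_upwards [hn] with ω hω
      refine (volume_restrict_setOf_lt_min_sub_max hω
        (upperEnd_sub_lowerEnd_le_two (fun i => a i ω) n) hx).trans ?_
      have hr := radius_eq a n ω
      rw [max_eq_left (by linarith)] at hr
      rw [Set.indicator_apply]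
      congr 1
      refine if_congr ?_ ?_ rfl
      · rw [Set.mem_ofPred_eq, hr]
        constructor <;> intro <;> linarith
      · rw [hr]
        congr 2
        ring
    · filter_upwards [hn] with ω hω
      refine Set.indicator_apply_nonneg fun h => ?_
      rw [Set.mem_ofPred_eq, radius_eq, max_eq_left (by linarith)] at h
      rw [radius_eq, max_eq_left (by linarith), sub_nonneg, div_le_one₀] <;>
        linarith [upperEnd_sub_lowerEnd_le_two (fun i => a i ω) n]
    · exact Measurable.aestronglyMeasurable (Measurable.indicator (by fun_prop) hset)

end IsDiminishingSegmentProcess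

/-! ### Tail bounds, tail limit and moments of the excess -/

theorem setOf_lt_natCast_mul {Ω : Type*} (f : Ω → ℝ) {n : ℕ} (hn : 0 < n) (t : ℝ) :
    {ω | t < n * f ω} = {ω | t / n < f ω} := by
  ext ω
  rw [Set.mem_ofPred_eq, Set.mem_ofPred_eq, div_lt_iff₀' (by exact_mod_cast hn)]

namespace IsRadiusExcess

variable {Ω : Type*} [MeasurableSpace Ω] {P : Measure Ω} [IsProbabilityMeasure P]
  {D : ℕ → Ω → ℝ}

theorem integrable (hD : IsRadiusExcess P D) (n : ℕ) : Integrable (D n) P :=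
  Integrable.of_mem_Icc 0 (1 / 2) (hD.measurable n).aemeasurable (hD.mem_Icc n)

theorem integrable_survival (hD : IsRadiusExcess P D) (n : ℕ) (x : ℝ) :
    Integrable (fun ω => 1 - 4 * x / (1 + 2 * D n ω)) P := by
  have hm := hD.measurable n
  have hm' : Measurable fun ω => 4 * x / (1 + 2 * D n ω) := by fun_prop
  refine (integrable_const 1).sub (Integrable.of_bound (C := |4 * x|) hm'.aestronglyMeasurable ?_)
  filter_upwards [hD.mem_Icc n] with ω hω
  rw [Real.norm_eq_abs, abs_div]
  refine div_le_self (abs_nonneg _) ?_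
  rw [abs_of_nonneg] <;> linarith [hω.1]

theorem measureReal_zero (hD : IsRadiusExcess P D) {x : ℝ} (hx : x < 1 / 2) :
    P.real {ω | x < D 0 ω} = 1 := by
  simp [hD.zero, show x < 2⁻¹ by linarith]

theorem mul_le_measureReal_succ (hD : IsRadiusExcess P D) (n : ℕ) {x : ℝ} (hx : 0 ≤ x) :
    P.real {ω | x < D n ω} * (1 - 4 * x) ≤ P.real {ω | x < D (n + 1) ω} := by
  rw [hD.measureReal_succ n x hx, ← smul_eq_mul, ← setIntegral_const]
  refine setIntegral_mono_ae (integrable_const _).integrableOn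
    (hD.integrable_survival n x).integrableOn ?_
  filter_upwards [hD.mem_Icc n] with ω hω
  have : 4 * x / (1 + 2 * D n ω) ≤ 4 * x := div_le_self (by linarith) (by linarith [hω.1])
  linarith

theorem measureReal_succ_le_mul (hD : IsRadiusExcess P D) (n : ℕ) {x : ℝ} (hx : 0 ≤ x) :
    P.real {ω | x < D (n + 1) ω} ≤ P.real {ω | x < D n ω} * (1 - 2 * x) := by
  rw [hD.measureReal_succ n x hx, ← smul_eq_mul (P.real _), ← setIntegral_const]
  refine setIntegral_mono_ae (hD.integrable_survival n x).integrableOn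
    (integrable_const _).integrableOn ?_
  filter_upwards [hD.mem_Icc n] with ω hω
  have : 2 * x ≤ 4 * x / (1 + 2 * D n ω) := by
    rw [le_div_iff₀ (by linarith [hω.1])]
    nlinarith [hω.2]
  linarith

theorem measureReal_succ_le_mul_add (hD : IsRadiusExcess P D) (n : ℕ) {x : ℝ} (hx : 0 ≤ x) :
    P.real {ω | x < D (n + 1) ω} ≤
      P.real {ω | x < D n ω} * (1 - 4 * x) + 8 * x * ∫ ω, D n ω ∂P := by
  have hi : Integrable (fun ω => 8 * x * D n ω) P := (hD.integrable n).const_mul _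
  have h₀ : ∀ᵐ ω ∂P, 0 ≤ 8 * x * D n ω := by
    filter_upwards [hD.mem_Icc n] with ω hω
    exact mul_nonneg (by linarith) hω.1
  calc P.real {ω | x < D (n + 1) ω}
      ≤ ∫ ω in {ω | x < D n ω}, ((1 - 4 * x) + 8 * x * D n ω) ∂P := by
        rw [hD.measureReal_succ n x hx]
        refine setIntegral_mono_ae (hD.integrable_survival n x).integrableOn
          ((integrable_const _).add hi).integrableOn ?_
        filter_upwards [hD.mem_Icc n] with ω hω
        -- This is 1/(1+2d) ≥ 1-2d, since (1-2d)(1+2d) = 1-4d² ≤ 1.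
        have : 4 * x - 8 * x * D n ω ≤ 4 * x / (1 + 2 * D n ω) := by
          rw [le_div_iff₀ (by linarith [hω.1])]
          nlinarith [mul_nonneg hx (sq_nonneg (D n ω))]
        linarith
    _ = P.real {ω | x < D n ω} * (1 - 4 * x) + ∫ ω in {ω | x < D n ω}, 8 * x * D n ω ∂P := by
        rw [integral_add (integrable_const _).integrableOn hi.integrableOn, setIntegral_const,
          smul_eq_mul]
    _ ≤ _ := by
        rw [← integral_const_mul]
        exact add_le_add_right (setIntegral_le_integral hi h₀) _

theorem pow_le_measureReal (hD : IsRadiusExcess P D) (n : ℕ) {x : ℝ} (hx : 0 ≤ x)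
    (hx' : x ≤ 1 / 4) : (1 - 4 * x) ^ n ≤ P.real {ω | x < D n ω} := by
  induction n with
  | zero => rw [hD.measureReal_zero (by linarith), pow_zero]
  | succ n ih =>
    rw [pow_succ]
    exact (mul_le_mul_of_nonneg_right ih (by linarith)).trans (hD.mul_le_measureReal_succ n hx)

theorem measureReal_le_pow_add (hD : IsRadiusExcess P D) (n : ℕ) {x : ℝ} (hx : 0 ≤ x)
    (hx' : x ≤ 1 / 4) : P.real {ω | x < D n ω} ≤
      (1 - 4 * x) ^ n + 8 * x * ∑ j ∈ Finset.range n, ∫ ω, D j ω ∂P := by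
  induction n with
  | zero => simp
  | succ n ih =>
    have hs : 0 ≤ 8 * x * ∑ j ∈ Finset.range n, ∫ ω, D j ω ∂P :=
      mul_nonneg (by linarith) (Finset.sum_nonneg fun j _ =>
        integral_nonneg_of_ae ((hD.mem_Icc j).mono fun ω hω => hω.1))
    rw [pow_succ, Finset.sum_range_succ]
    -- The error accumulated so far is multiplied by `1 - 4 * x ≤ 1`, so errors merely add up.
    nlinarith [hD.measureReal_succ_le_mul_add n hx]

theorem measureReal_le_exp (hD : IsRadiusExcess P D) (n : ℕ) {x : ℝ} (hx : 0 ≤ x) :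
    P.real {ω | x < D n ω} ≤ Real.exp (-2 * n * x) := by
  -- Beyond 1/2 the factor `1 - 2 * x` is negative and cannot be iterated, but there the tail
  -- vanishes.
  rcases le_or_gt x (1 / 2) with hx' | hx'
  · have h : P.real {ω | x < D n ω} ≤ (1 - 2 * x) ^ n := by
      induction n with
      | zero => simp
      | succ n ih =>
        rw [pow_succ]
        exact (hD.measureReal_succ_le_mul n hx).trans
          (mul_le_mul_of_nonneg_right ih (by linarith))
    refine h.trans ((pow_le_pow_left₀ (by linarith) (Real.one_sub_le_exp_neg (2 * x)) n).trans_eq ?_)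
    rw [← Real.exp_nat_mul]
    congr 1
    ring
  · have : P.real {ω | x < D n ω} = 0 := by
      rw [measureReal_def, measure_eq_zero_iff_ae_notMem.2, ENNReal.toReal_zero]
      filter_upwards [hD.mem_Icc n] with ω hω
      exact not_lt.2 (hω.2.trans hx'.le)
    rw [this]
    exact (Real.exp_pos _).le

/-- Integrating the crude exponential tail bounds the mean by 1/(2n). -/
theorem tendsto_integral_zero (hD : IsRadiusExcess P D) :
    Tendsto (fun n => ∫ ω, D n ω ∂P) atTop (𝓝 0) := by
  have hlim : Tendsto (fun n : ℕ => (2 * n : ℝ)⁻¹) atTop (𝓝 0) :=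
    (tendsto_natCast_atTop_atTop.const_mul_atTop two_pos).inv_tendsto_atTop
  refine tendsto_of_tendsto_of_tendsto_of_le_of_le' tendsto_const_nhds hlim
    (Eventually.of_forall fun n => integral_nonneg_of_ae ((hD.mem_Icc n).mono fun ω hω => hω.1)) ?_
  filter_upwards [eventually_gt_atTop 0] with n hn
  have hn' : (0 : ℝ) < n := by exact_mod_cast hn
  rw [(hD.integrable n).integral_eq_integral_meas_lt ((hD.mem_Icc n).mono fun ω hω => hω.1)]
  have he := integral_exp_mul_Ioi (a := -2 * n) (by linarith) 0
  rw [mul_zero, Real.exp_zero] at he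
  calc _ ≤ ∫ x in Set.Ioi (0 : ℝ), Real.exp (-2 * n * x) := by
        refine integral_mono_of_nonneg (Eventually.of_forall fun x => measureReal_nonneg)
          (integrableOn_exp_mul_Ioi (by linarith) 0) ?_
        filter_upwards [ae_restrict_mem measurableSet_Ioi] with x hx
        exact hD.measureReal_le_exp n (le_of_lt hx)
    _ = _ := by
        rw [he]
        field_simp

theorem tendsto_measureReal (hD : IsRadiusExcess P D) {t : ℝ} (ht : 0 ≤ t) :
    Tendsto (fun n : ℕ => P.real {ω | t < n * D n ω}) atTop (𝓝 (Real.exp (-4 * t))) := by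
  have h₁ := Real.tendsto_one_add_div_pow_exp (-4 * t)
  have h₂ := h₁.add (hD.tendsto_integral_zero.cesaro.const_mul (8 * t))
  rw [mul_zero, add_zero] at h₂
  refine tendsto_of_tendsto_of_tendsto_of_le_of_le' h₁ h₂ ?_ ?_ <;>
  -- `n ≥ 4t` puts `x = t / n` in the range `x ≤ 1 / 4` of the power bounds.
  · filter_upwards [eventually_gt_atTop 0, eventually_ge_atTop ⌈4 * t⌉₊] with n hn hnt
    have hn' : (0 : ℝ) < n := by exact_mod_cast hn
    have hnt' : 4 * t ≤ n := Nat.ceil_le.1 hnt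
    have hx : t / n ≤ 1 / 4 := by
      rw [div_le_iff₀ hn']
      linarith
    rw [setOf_lt_natCast_mul _ hn]
    have e : 1 + -4 * t / n = 1 - 4 * (t / n) := by ring
    rw [e]
    first
    | exact hD.pow_le_measureReal n (by positivity) hx
    | refine (hD.measureReal_le_pow_add n (by positivity) hx).trans_eq ?_
      ring

/-- Uniformity in `n` makes this the majorant for the moments. -/
theorem measureReal_natCast_mul_le (hD : IsRadiusExcess P D) {n : ℕ} (hn : 0 < n) {t : ℝ}
    (ht : 0 ≤ t) : P.real {ω | t < n * D n ω} ≤ Real.exp (-2 * t) := by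
  rw [setOf_lt_natCast_mul _ hn]
  refine (hD.measureReal_le_exp n (by positivity)).trans_eq ?_
  have hn' : (n : ℝ) ≠ 0 := by exact_mod_cast hn.ne'
  congr 1
  field_simp

theorem integrable_pow (hD : IsRadiusExcess P D) (n k : ℕ) :
    Integrable (fun ω => (n * D n ω) ^ k) P := by
  refine Integrable.of_mem_Icc 0 ((n * (1 / 2)) ^ k)
    (((hD.measurable n).const_mul _).pow_const k).aemeasurable ?_
  filter_upwards [hD.mem_Icc n] with ω hω
  have h₀ : 0 ≤ n * D n ω := mul_nonneg n.cast_nonneg hω.1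
  exact ⟨pow_nonneg h₀ k, pow_le_pow_left₀ h₀ (mul_le_mul_of_nonneg_left hω.2 n.cast_nonneg) k⟩

theorem integral_pow_eq (hD : IsRadiusExcess P D) (n : ℕ) {k : ℕ} (hk : 1 ≤ k) :
    ∫ ω, (n * D n ω) ^ k ∂P =
      ∫ s in Set.Ioi (0 : ℝ), P.real {ω | s ^ (k : ℝ)⁻¹ < n * D n ω} := by
  have h₀ : ∀ᵐ ω ∂P, 0 ≤ n * D n ω :=
    (hD.mem_Icc n).mono fun ω hω => mul_nonneg n.cast_nonneg hω.1
  rw [(hD.integrable_pow n k).integral_eq_integral_meas_lt (h₀.mono fun ω hω => pow_nonneg hω k)]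
  refine setIntegral_congr_fun measurableSet_Ioi fun s hs => measureReal_congr ?_
  filter_upwards [h₀] with ω hω
  refine propext ?_
  change s < (n * D n ω) ^ k ↔ s ^ (k : ℝ)⁻¹ < n * D n ω
  rw [Real.rpow_inv_lt_iff_of_pos (le_of_lt hs) hω (by exact_mod_cast hk), Real.rpow_natCast]

theorem integral_exp_neg_mul_rpow_inv {k : ℕ} (hk : 1 ≤ k) {b : ℝ} (hb : 0 < b) :
    ∫ s in Set.Ioi (0 : ℝ), Real.exp (-b * s ^ (k : ℝ)⁻¹) = k ! / b ^ k := by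
  have hk' : (0 : ℝ) < k := by exact_mod_cast hk
  rw [integral_exp_neg_mul_rpow (inv_pos.2 hk') hb, one_div, inv_inv, Real.Gamma_nat_eq_factorial,
    neg_div, one_div, inv_inv, Real.rpow_neg hb.le, Real.rpow_natCast]
  ring

theorem tendsto_integral_pow (hD : IsRadiusExcess P D) {k : ℕ} (hk : 1 ≤ k) :
    Tendsto (fun n : ℕ => ∫ ω, (n * D n ω) ^ k ∂P) atTop (𝓝 ((k ! : ℝ) / 4 ^ k)) := by
  simp only [hD.integral_pow_eq _ hk, ← integral_exp_neg_mul_rpow_inv hk four_pos]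
  refine tendsto_integral_filter_of_dominated_convergence
    (fun s => Real.exp (-2 * s ^ (k : ℝ)⁻¹)) (Eventually.of_forall fun n => ?_) ?_ ?_ ?_
  -- Measurability in the level comes from monotonicity of the tail.
  · have hanti : Antitone fun t : ℝ => P.real {ω | t < n * D n ω} := fun t t' h =>
      measureReal_mono fun ω hω => h.trans_lt hω
    exact (hanti.measurable.comp (by fun_prop)).aestronglyMeasurable
  · filter_upwards [eventually_gt_atTop 0] with n hn
    filter_upwards [ae_restrict_mem measurableSet_Ioi] with s hs
    rw [Real.norm_of_nonneg measureReal_nonneg]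
    exact hD.measureReal_natCast_mul_le hn (Real.rpow_nonneg (le_of_lt hs) _)
  -- A non-integrable function has integral 0 by convention, whereas this integral is k!/2^k ≠ 0.
  · refine not_imp_comm.1 integral_undef ?_
    rw [integral_exp_neg_mul_rpow_inv hk two_pos]
    positivity
  · filter_upwards [ae_restrict_mem measurableSet_Ioi] with s hs
    exact hD.tendsto_measureReal (Real.rpow_nonneg (le_of_lt hs) _)

end IsRadiusExcess

/-! ### From tails to convergence in distribution -/

/-- Probability measures on the line converge weakly if their survival functions converge. -/
theorem tendsto_probabilityMeasure_of_tendsto_Ioi {ι : Type*} {l : Filter ι}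
    [l.IsCountablyGenerated] {μs : ι → ProbabilityMeasure ℝ} {μ : ProbabilityMeasure ℝ}
    (h : ∀ t, Tendsto (fun i => (μs i : Measure ℝ).real (Set.Ioi t)) l
      (𝓝 ((μ : Measure ℝ).real (Set.Ioi t)))) : Tendsto μs l (𝓝 μ) := by
  -- Half-open intervals form a π-system containing small neighbourhoods of every point, and their
  -- masses are differences of tails.
  refine (isPiSystem_Ioc (id : ℝ → ℝ) id).tendsto_probabilityMeasure_of_tendsto_of_mem ?_ ?_ ?_
  · rintro _ ⟨a, b, _, rfl⟩
    exact measurableSet_Ioc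
  · intro u hu x hx
    obtain ⟨ε, hε, hεu⟩ := Metric.isOpen_iff.1 hu x hx
    refine ⟨_, ⟨x - ε / 2, x + ε / 2, by simp only [id]; linarith, rfl⟩,
      Ioc_mem_nhds (by simp only [id]; linarith) (by simp only [id]; linarith), fun y hy => hεu ?_⟩
    rw [Metric.mem_ball, Real.dist_eq, abs_lt]
    obtain ⟨h₁, h₂⟩ := hy
    simp only [id] at h₁ h₂
    constructor <;> linarith
  · rintro _ ⟨a, b, hab, rfl⟩
    have key : ∀ ν : ProbabilityMeasure ℝ, ((ν (Set.Ioc a b) : NNReal) : ℝ) =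
        (ν : Measure ℝ).real (Set.Ioi a) - (ν : Measure ℝ).real (Set.Ioi b) := by
      intro ν
      rw [← measureReal_sdiff (Set.Ioi_subset_Ioi (show a ≤ b from le_of_lt hab)) measurableSet_Ioi,
        Set.Ioi_sdiff_Ioi]
      rfl
    rw [← NNReal.tendsto_coe]
    simp only [id, key]
    exact (h a).sub (h b)

theorem expMeasure_real_Ioi {r : ℝ} (hr : 0 < r) (t : ℝ) :
    (expMeasure r).real (Set.Ioi t) = if 0 ≤ t then Real.exp (-(r * t)) else 1 := by
  have := isProbabilityMeasure_expMeasure hr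
  rw [← Set.compl_Iic, probReal_compl_eq_one_sub measurableSet_Iic, ← cdf_eq_real,
    cdf_expMeasure_eq hr]
  split_ifs <;> ring

theorem IsRadiusExcess.tendstoInDistribution {Ω : Type*} [MeasurableSpace Ω] {P : Measure Ω}
    [IsProbabilityMeasure P] {D : ℕ → Ω → ℝ} (hD : IsRadiusExcess P D) :
    TendstoInDistribution (fun (n : ℕ) ω => (n : ℝ) * D n ω) atTop (id : ℝ → ℝ) (fun _ => P)
      (expMeasure 4) where
  forall_aemeasurable n := ((hD.measurable n).const_mul _).aemeasurable
  aemeasurable_limit := aemeasurable_id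
  tendsto := by
    refine tendsto_probabilityMeasure_of_tendsto_Ioi fun t => ?_
    simp only [ProbabilityMeasure.coe_mk, Measure.map_id, expMeasure_real_Ioi four_pos]
    have hmap : ∀ n : ℕ, (P.map fun ω => (n : ℝ) * D n ω).real (Set.Ioi t) =
        P.real {ω | t < n * D n ω} := fun n =>
      map_measureReal_apply ((hD.measurable n).const_mul _) measurableSet_Ioi
    simp only [hmap]
    split_ifs with ht
    · simpa only [neg_mul] using hD.tendsto_measureReal ht
    -- For `t < 0` every tail is already 1, the excess being almost surely nonnegative.
    · refine tendsto_const_nhds.congr fun n => ?_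
      rw [eq_comm, measureReal_def, ← ENNReal.toReal_one, ← measure_univ (μ := P)]
      refine congrArg _ (measure_eq_measure_of_null_sdiff (Set.subset_univ _) ?_)
      rw [← Set.compl_eq_univ_sdiff]
      change ∀ᵐ ω ∂P, t < n * D n ω
      filter_upwards [hD.mem_Icc n] with ω hω
      exact (not_le.1 ht).trans_le (mul_nonneg n.cast_nonneg hω.1)

theorem theorem1 {Ω : Type*} [MeasurableSpace Ω] (P : Measure Ω) [IsProbabilityMeasure P]
    (a : ℕ → Ω → ℝ) (ha : IsDiminishingSegmentProcess P a) :
    TendstoInDistribution (fun (n : ℕ) ω => (n : ℝ) * (radius a n ω - 1 / 2)) atTop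
        (id : ℝ → ℝ) (fun _ => P) (expMeasure 4) ∧
      ∀ k : ℕ, 1 ≤ k →
        (∀ n : ℕ, Integrable (fun ω => (n : ℝ) ^ k * (radius a n ω - 1 / 2) ^ k) P) ∧
        Tendsto (fun n : ℕ => ∫ ω, (n : ℝ) ^ k * (radius a n ω - 1 / 2) ^ k ∂P) atTop
          (𝓝 ((k ! : ℝ) / 4 ^ k)) := by
  have hD := ha.isRadiusExcess
  refine ⟨hD.tendstoInDistribution, fun k hk => ?_⟩
  simp only [← mul_pow]
  exact ⟨fun n => hD.integrable_pow n k, hD.tendsto_integral_pow hk⟩
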